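/- Let $k$ be a field, $R$ a finite-dimensional (associative, unital) $k$-algebra, and ${}_R\mathrm{Mod}_R$ the monoidal category of $R$-bimodules (with $k$ acting centrally), with monoidal product $\otimes_R$ and unit $R$. An \emph{$R$-Hopf algebroid} $B$ is a $k$-linear bimonad $T$ on ${}_R\mathrm{Mod}_R$ (a monad with multiplication $\mu$ and unit $\eta$ whose underlying functor is opmonoidal, with structure $\upsilon^2_{X,Y}\colon T(X\otimes_R Y)\to T(X)\otimes_R T(Y)$ and $\upsilon^0\colon T(R)\to R$, such that $\mu$ and $\eta$ are opmonoidal natural transformations) which admits a right adjoint and whose left and right fusion operators $$(\mu_X\otimes_R T(Y))\circ\upsilon^2_{T(X),Y}\colon T(T(X)\otimes_R Y)\to T(X)\otimes_R T(Y),\qquad (T(X)\otimes_R\mu_Y)\circ\upsilon^2_{X,T(Y)}\colon T(X\otimes_R T(Y))\to T(X)\otimes_R T(Y)$$ are invertible for all $R$-bimodules $X,Y$. (For the bialgebroid with total algebra $B$ one has $T=B\otimes_{R\otimes_k R^{\mathrm{op}}}-$.) A $B$-module is a $T$-module; $B$-modules form a monoidal category with $(M,\omega)\otimes(N,\gamma)=(M\otimes_R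 N,(\omega\otimes_R\gamma)\circ\upsilon^2_{M,N})$ and unit $(R,\upsilon^0)$. Let $B\text{-mod}^{\mathrm{fd}}$ and ${}_R\mathrm{Mod}_R^{\mathrm{fd}}$ be the full monoidal subcategories of $B$-modules and $R$-bimodules that are finite-dimensional over $k$. Let $R^*=\operatorname{Hom}_k(R,k)$ be the $R$-bimodule with $(z.f.x)(y)=f(xyz)$. An object $K$ of a monoidal category $\mathcal C$ is \emph{dualizing} if for every $Y\in\mathcal C$ the functor $\operatorname{Hom}_{\mathcal C}(-\otimes Y,K)$ is representable by some object $DY$ and the induced contravariant functor $D$ on $\mathcal C$ is an antiequivalence. A monoidal category is \emph{closed} if all functors $X\otimes -$ and $-\otimes X$ have right adjoints (internal homs); a lax monoidal functor $F$ is \emph{closed} if its source and target are closed monoidal categories and the canonical comparison morphisms from $F$ of the (left, right) internal hom of $X$ and $Y$ to the (left, right) internal hom of $F(X)$ and $F(Y)$ are all invertible. Then: \begin{enumerate} \item For every $B$-module structure on the $R$-bimodule $R^*$, the resulting $B$-module is a dualizing object of $B\text{-mod}^{\mathrm{fd}}$. \item The forgetful functor $B\text{-mod}^{\mathrm{fd}}\to{}_R\mathrm{Mod}_R^{\mathrm{fd}}$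 is strict monoidal and closed (in particular both categories are closed), and it strictly preserves the dualizing object: it sends each $B$-module as in (1) to the $R$-bimodule $R^*$, which is a dualizing object of ${}_R\mathrm{Mod}_R^{\mathrm{fd}}$. \end{enumerate} -/

import Mathlib

open CategoryTheory MonoidalCategory

universe u

namespace HopfAlgebroidGV

/-! ### Dualizing objects -/

section Dualizing

variable {C : Type*} [Category* C] [MonoidalCategory C]

/-- A duality functor for `K`: a contravariant functor `D` together with, for every `Y`, a
representation of the presheaf `Hom(- ⊗ Y, K)` by `D Y`, such that the action of `D` on morphisms
is the one induced by the representations. -/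
structure DualityFunctor (K : C) where
  /-- the functor `D` -/
  D : Cᵒᵖ ⥤ C
  /-- `D Y` represents `Hom(- ⊗ Y, K)` -/
  repr (Y : C) : ((tensorRight Y).op ⋙ yoneda.obj K).RepresentableBy (D.obj (Opposite.op Y))
  /-- the bijections `Hom(X, D Y) ≃ Hom(X ⊗ Y, K)` are natural in `Y` -/
  repr_naturality {X Y Y' : C} (h : Y' ⟶ Y) (f : X ⟶ D.obj (Opposite.op Y)) :
    ((repr Y').homEquiv (f ≫ D.map h.op) : X ⊗ Y' ⟶ K) =
      X ◁ h ≫ ((repr Y).homEquiv f : X ⊗ Y ⟶ K)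

/-- `K` is dualizing: each presheaf `Hom(- ⊗ Y, K)` is representable by some object `D Y`, and the
induced contravariant functor `D` is an antiequivalence. -/
def IsDualizing (K : C) : Prop :=
  ∃ 𝔇 : DualityFunctor K, 𝔇.D.IsEquivalence

end Dualizing

/-! ### Closed and strict monoidal functors -/

section Closed

variable {C : Type*} [Category* C] [MonoidalCategory C]
  {D : Type*} [Category* D] [MonoidalCategory D]

/-- A monoidal category is closed if all functors `X ⊗ -` and `- ⊗ X` have right adjoints. -/
structure IsClosedMonoidal (C : Type*) [Category* C] [MonoidalCategory C] : Prop where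
  left (X : C) : (tensorLeft X).IsLeftAdjoint
  right (X : C) : (tensorRight X).IsLeftAdjoint

/-- The left comparator `F (X ⊸ Y) ⟶ F X ⊸ F Y` of a lax monoidal functor, where `X ⊸ -` and
`F X ⊸ -` are given right adjoints `G` and `H` of `X ⊗ -` and `F X ⊗ -`. -/
def leftComparator (F : C ⥤ D) [F.LaxMonoidal] {X : C} {G : C ⥤ C} (adj : tensorLeft X ⊣ G)
    {H : D ⥤ D} (adj' : tensorLeft (F.obj X) ⊣ H) (Y : C) :
    F.obj (G.obj Y) ⟶ H.obj (F.obj Y) :=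
  adj'.homEquiv _ _ (Functor.LaxMonoidal.μ F X (G.obj Y) ≫ F.map (adj.counit.app Y))

/-- The right comparator of a lax monoidal functor, where the right internal homs are given by
right adjoints `G` and `H` of `- ⊗ X` and `- ⊗ F X`. -/
def rightComparator (F : C ⥤ D) [F.LaxMonoidal] {X : C} {G : C ⥤ C} (adj : tensorRight X ⊣ G)
    {H : D ⥤ D} (adj' : tensorRight (F.obj X) ⊣ H) (Y : C) :
    F.obj (G.obj Y) ⟶ H.obj (F.obj Y) :=
  adj'.homEquiv _ _ (Functor.LaxMonoidal.μ F (G.obj Y) X ≫ F.map (adj.counit.app Y))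

/-- A lax monoidal functor is closed if source and target are closed monoidal categories and its
left and right internal hom comparators are invertible (for any choice of internal homs). -/
structure IsClosedFunctor (F : C ⥤ D) [F.LaxMonoidal] : Prop where
  source : IsClosedMonoidal C
  target : IsClosedMonoidal D
  left {X : C} {G : C ⥤ C} (adj : tensorLeft X ⊣ G) {H : D ⥤ D}
    (adj' : tensorLeft (F.obj X) ⊣ H) (Y : C) : IsIso (leftComparator F adj adj' Y)
  right {X : C} {G : C ⥤ C} (adj : tensorRight X ⊣ G) {H : D ⥤ D}
    (adj' : tensorRight (F.obj X) ⊣ H) (Y : C) : IsIso (rightComparator F adj adj' Y)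

/-- A lax monoidal functor is strict if it preserves unit and tensor products of objects on the
nose and its structure morphisms are identities. -/
structure IsStrictMonoidal (F : C ⥤ D) [F.LaxMonoidal] : Prop where
  obj_unit : 𝟙_ D = F.obj (𝟙_ C)
  obj_tensor (X Y : C) : F.obj X ⊗ F.obj Y = F.obj (X ⊗ Y)
  ε_eq : Functor.LaxMonoidal.ε F = eqToHom obj_unit
  μ_eq (X Y : C) : Functor.LaxMonoidal.μ F X Y = eqToHom (obj_tensor X Y)

end Closed

/-! ### Bimonads and Hopf monads -/

section Bimonad

variable {C : Type*} [Category* C] [MonoidalCategory C]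

open Functor.OplaxMonoidal

/-- A monad with an opmonoidal structure on its endofunctor is a bimonad if its multiplication
and unit are opmonoidal natural transformations. -/
class IsBimonad (T : Monad C) [T.toFunctor.OplaxMonoidal] : Prop where
  mul_δ (X Y : C) :
    T.μ.app (X ⊗ Y) ≫ δ T.toFunctor X Y =
      T.map (δ T.toFunctor X Y) ≫ δ T.toFunctor (T.obj X) (T.obj Y) ≫
        (T.μ.app X ⊗ₘ T.μ.app Y)
  mul_η : T.μ.app (𝟙_ C) ≫ η T.toFunctor = T.map (η T.toFunctor) ≫ η T.toFunctor
  unit_δ (X Y : C) : T.η.app (X ⊗ Y) ≫ δ T.toFunctor X Y = T.η.app X ⊗ₘ T.η.app Y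
  unit_η : T.η.app (𝟙_ C) ≫ η T.toFunctor = 𝟙 (𝟙_ C)

variable (T : Monad C) [T.toFunctor.OplaxMonoidal]

/-- The left fusion operator `T (T X ⊗ Y) ⟶ T X ⊗ T Y`. -/
def leftFusion (X Y : C) : T.obj (T.obj X ⊗ Y) ⟶ T.obj X ⊗ T.obj Y :=
  δ T.toFunctor (T.obj X) Y ≫ T.μ.app X ▷ T.obj Y

/-- The right fusion operator `T (X ⊗ T Y) ⟶ T X ⊗ T Y`. -/
def rightFusion (X Y : C) : T.obj (X ⊗ T.obj Y) ⟶ T.obj X ⊗ T.obj Y :=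
  δ T.toFunctor X (T.obj Y) ≫ T.obj X ◁ T.μ.app Y

/-- A bimonad is Hopf if both fusion operators are invertible. -/
structure IsHopfMonad : Prop where
  left (X Y : C) : IsIso (leftFusion T X Y)
  right (X Y : C) : IsIso (rightFusion T X Y)

variable {T}

theorem tensorHom_h {M M' N N' : T.Algebra} (f : M ⟶ M') (g : N ⟶ N') :
    T.map (f.f ⊗ₘ g.f) ≫ δ T.toFunctor M'.A N'.A ≫ (M'.a ⊗ₘ N'.a) =
      (δ T.toFunctor M.A N.A ≫ (M.a ⊗ₘ N.a)) ≫ (f.f ⊗ₘ g.f) := by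
  rw [← Category.assoc, ← δ_natural, Category.assoc, Category.assoc,
    tensorHom_comp_tensorHom, tensorHom_comp_tensorHom, f.h, g.h]

theorem associator_h (L M N : T.Algebra) :
    T.map (α_ L.A M.A N.A).hom ≫ δ T.toFunctor L.A (M.A ⊗ N.A) ≫
        (L.a ⊗ₘ (δ T.toFunctor M.A N.A ≫ (M.a ⊗ₘ N.a))) =
      (δ T.toFunctor (L.A ⊗ M.A) N.A ≫
        ((δ T.toFunctor L.A M.A ≫ (L.a ⊗ₘ M.a)) ⊗ₘ N.a)) ≫ (α_ L.A M.A N.A).hom := by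
  have h := Functor.OplaxMonoidal.associativity (F := T.toFunctor) L.A M.A N.A
  have h₁ : (L.a ⊗ₘ (δ T.toFunctor M.A N.A ≫ (M.a ⊗ₘ N.a))) =
      T.obj L.A ◁ δ T.toFunctor M.A N.A ≫ (L.a ⊗ₘ (M.a ⊗ₘ N.a)) := by
    rw [← id_tensorHom, tensorHom_comp_tensorHom, Category.id_comp]
  have h₂ : ((δ T.toFunctor L.A M.A ≫ (L.a ⊗ₘ M.a)) ⊗ₘ N.a) =
      δ T.toFunctor L.A M.A ▷ T.obj N.A ≫ ((L.a ⊗ₘ M.a) ⊗ₘ N.a) := by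
    rw [← tensorHom_id, tensorHom_comp_tensorHom, Category.id_comp]
  rw [h₁, h₂]
  simp only [Category.assoc, associator_naturality]
  rw [← reassoc_of% h]

theorem leftUnitor_h (M : T.Algebra) :
    T.map (λ_ M.A).hom ≫ M.a =
      (δ T.toFunctor (𝟙_ C) M.A ≫ (η T.toFunctor ⊗ₘ M.a)) ≫ (λ_ M.A).hom := by
  rw [Category.assoc, MonoidalCategory.tensorHom_def, Category.assoc, leftUnitor_naturality]
  simp

theorem rightUnitor_h (M : T.Algebra) :
    T.map (ρ_ M.A).hom ≫ M.a =
      (δ T.toFunctor M.A (𝟙_ C) ≫ (M.a ⊗ₘ η T.toFunctor)) ≫ (ρ_ M.A).hom := by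
  rw [Category.assoc, MonoidalCategory.tensorHom_def', Category.assoc, rightUnitor_naturality]
  simp

variable [IsBimonad T]

/-- The tensor product of two modules over a bimonad. -/
@[simps]
def algebraTensor (M N : T.Algebra) : T.Algebra where
  A := M.A ⊗ N.A
  a := δ T.toFunctor M.A N.A ≫ (M.a ⊗ₘ N.a)
  unit := by
    rw [← Category.assoc, IsBimonad.unit_δ, tensorHom_comp_tensorHom, M.unit, N.unit]
    simp
  assoc := by
    rw [← Category.assoc, IsBimonad.mul_δ]
    simp only [Category.assoc, tensorHom_comp_tensorHom, M.assoc, N.assoc, Functor.map_comp]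
    rw [← tensorHom_comp_tensorHom, ← Category.assoc (δ T.toFunctor _ _), δ_natural]
    simp only [Category.assoc]

variable (T) in
/-- The unit object with its canonical module structure over a bimonad. -/
@[simps]
def algebraUnit : T.Algebra where
  A := 𝟙_ C
  a := η T.toFunctor
  unit := IsBimonad.unit_η
  assoc := IsBimonad.mul_η

/-- The monoidal category of modules over a bimonad; the underlying objects of tensor product and
unit, and the underlying morphisms of all structure morphisms, are those of `C`. -/
instance : MonoidalCategory T.Algebra where
  tensorObj M N := algebraTensor M N
  tensorUnit := algebraUnit T
  whiskerLeft M _ _ f :=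
    { f := M.A ◁ f.f
      h := by simpa only [Monad.Algebra.id_f, id_tensorHom] using! tensorHom_h (𝟙 M) f }
  whiskerRight f N :=
    { f := f.f ▷ N.A
      h := by simpa only [Monad.Algebra.id_f, tensorHom_id] using! tensorHom_h f (𝟙 N) }
  tensorHom f g := { f := f.f ⊗ₘ g.f, h := tensorHom_h f g }
  associator L M N := Monad.Algebra.isoMk (α_ L.A M.A N.A) (associator_h L M N)
  leftUnitor M := Monad.Algebra.isoMk (λ_ M.A) (leftUnitor_h M)
  rightUnitor M := Monad.Algebra.isoMk (ρ_ M.A) (rightUnitor_h M)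
  tensorHom_def f g := Monad.Algebra.Hom.ext' _ _ _ _ (tensorHom_def f.f g.f)
  id_tensorHom_id M N := Monad.Algebra.Hom.ext' _ _ _ _ (id_tensorHom_id M.A N.A)
  tensorHom_comp_tensorHom f₁ f₂ g₁ g₂ :=
    Monad.Algebra.Hom.ext' _ _ _ _ (tensorHom_comp_tensorHom f₁.f f₂.f g₁.f g₂.f)
  whiskerLeft_id M N := Monad.Algebra.Hom.ext' _ _ _ _ (whiskerLeft_id M.A N.A)
  id_whiskerRight M N := Monad.Algebra.Hom.ext' _ _ _ _ (id_whiskerRight M.A N.A)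
  associator_naturality f₁ f₂ f₃ :=
    Monad.Algebra.Hom.ext' _ _ _ _ (associator_naturality f₁.f f₂.f f₃.f)
  leftUnitor_naturality f := Monad.Algebra.Hom.ext' _ _ _ _ (leftUnitor_naturality f.f)
  rightUnitor_naturality f := Monad.Algebra.Hom.ext' _ _ _ _ (rightUnitor_naturality f.f)
  pentagon K L M N := Monad.Algebra.Hom.ext' _ _ _ _ (pentagon K.A L.A M.A N.A)
  triangle M N := Monad.Algebra.Hom.ext' _ _ _ _ (triangle M.A N.A)

variable (P : ObjectProperty C) [P.IsMonoidal]

variable (T) in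
/-- The modules over `T` whose underlying object satisfies `P`. -/
abbrev moduleProp : ObjectProperty T.Algebra := P.inverseImage T.forget

instance : (moduleProp T P).IsMonoidal where
  prop_unit := P.prop_unit
  prop_tensor _ _ h₁ h₂ := ObjectProperty.prop_tensor (P₁ := P) (P₂ := P) (Q := P) h₁ h₂

variable (T) in
/-- The forgetful functor from the `T`-modules with underlying object in `P` to `P`. -/
def forgetFull : (moduleProp T P).FullSubcategory ⥤ P.FullSubcategory :=
  P.lift ((moduleProp T P).ι ⋙ T.forget) (fun M => M.property)

/-- The monoidal structure of the forgetful functor; its structure morphisms are identities. -/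
instance : (forgetFull T P).Monoidal :=
  Functor.CoreMonoidal.toMonoidal
    { εIso := Iso.refl _
      μIso _ _ := Iso.refl _
      μIso_hom_natural_left _ _ := (Category.comp_id _).trans (Category.id_comp _).symm
      μIso_hom_natural_right _ _ := (Category.comp_id _).trans (Category.id_comp _).symm
      associativity X Y Z := by
        ext
        exact (show 𝟙 (X.obj.A ⊗ Y.obj.A) ▷ Z.obj.A ≫ 𝟙 _ ≫ (α_ X.obj.A Y.obj.A Z.obj.A).hom =
          (α_ X.obj.A Y.obj.A Z.obj.A).hom ≫ X.obj.A ◁ 𝟙 (Y.obj.A ⊗ Z.obj.A) ≫ 𝟙 _ by simp)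
      left_unitality X := by
        ext
        exact (show (λ_ X.obj.A).hom = 𝟙 (𝟙_ C) ▷ X.obj.A ≫ 𝟙 _ ≫ (λ_ X.obj.A).hom by simp)
      right_unitality X := by
        ext
        exact (show (ρ_ X.obj.A).hom = X.obj.A ◁ 𝟙 (𝟙_ C) ≫ 𝟙 _ ≫ (ρ_ X.obj.A).hom by simp) }

end Bimonad

/-! ### Bimodules -/

section Bimodules

section Linear

variable {C : Type*} [Category* C] [MonoidalCategory C] [Preadditive C] [MonoidalPreadditive C]
  {A B : Mon C}

/-- Morphisms of bimodules are added through their underlying morphisms. -/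
instance : Preadditive (Bimod A B) where
  homGroup M N :=
    letI : Zero (M ⟶ N) := ⟨{ hom := 0 }⟩
    letI : Add (M ⟶ N) := ⟨fun f g => { hom := f.hom + g.hom }⟩
    letI : Neg (M ⟶ N) := ⟨fun f =>
      { hom := -f.hom
        left_act_hom := by
          rw [show A.X ◁ (-f.hom) = -(A.X ◁ f.hom) from (tensoringLeft C).obj A.X |>.map_neg]
          simp
        right_act_hom := by
          rw [show (-f.hom) ▷ B.X = -(f.hom ▷ B.X) from (tensorRight B.X).map_neg]
          simp }⟩
    { add_assoc f g h := Bimod.hom_ext _ _ (add_assoc f.hom g.hom h.hom)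
      zero_add f := Bimod.hom_ext _ _ (zero_add f.hom)
      add_zero f := Bimod.hom_ext _ _ (add_zero f.hom)
      nsmul := nsmulRec
      zsmul := zsmulRec
      neg_add_cancel f := Bimod.hom_ext _ _ (neg_add_cancel f.hom)
      add_comm f g := Bimod.hom_ext _ _ (add_comm f.hom g.hom) }
  add_comp _ _ _ f f' g := Bimod.hom_ext _ _ (Preadditive.add_comp _ _ _ f.hom f'.hom g.hom)
  comp_add _ _ _ f g g' := Bimod.hom_ext _ _ (Preadditive.comp_add _ _ _ f.hom g.hom g'.hom)

variable (k : Type*) [CommRing k] [Linear k C] [MonoidalLinear k C]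

/-- Scalars act on morphisms of bimodules through the underlying morphisms. -/
instance : Linear k (Bimod A B) where
  homModule M N :=
    letI : SMul k (M ⟶ N) := ⟨fun c f => { hom := c • f.hom }⟩
    { one_smul f := Bimod.hom_ext _ _ (one_smul k f.hom)
      mul_smul c d f := Bimod.hom_ext _ _ (mul_smul c d f.hom)
      smul_zero c := Bimod.hom_ext _ _ (smul_zero c)
      smul_add c f g := Bimod.hom_ext _ _ (smul_add c f.hom g.hom)
      add_smul c d f := Bimod.hom_ext _ _ (add_smul c d f.hom)
      zero_smul f := Bimod.hom_ext _ _ (zero_smul k f.hom) }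
  smul_comp _ _ _ c f g := Bimod.hom_ext _ _ (Linear.smul_comp _ _ _ c f.hom g.hom)
  comp_smul _ _ _ f c g := Bimod.hom_ext _ _ (Linear.comp_smul _ _ _ f.hom c g.hom)

end Linear

section Monoidal

open Limits

variable {C : Type*} [Category* C] [MonoidalCategory C] [HasCoequalizers C]
  [∀ X : C, PreservesColimitsOfSize.{0, 0} (tensorLeft X)]
  [∀ X : C, PreservesColimitsOfSize.{0, 0} (tensorRight X)]

/-- The monoidal category of bimodules over an algebra `A`: the monoidal product is the tensor
product over `A` and the unit is the regular bimodule. -/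
noncomputable instance (A : Mon C) : MonoidalCategory (Bimod A A) where
  tensorObj M N := M.tensorBimod N
  tensorUnit := Bimod.regular A
  whiskerLeft M _ _ f := Bimod.whiskerLeft M f
  whiskerRight f N := Bimod.whiskerRight f N
  associator L M N := Bimod.associatorBimod L M N
  leftUnitor M := Bimod.leftUnitorBimod M
  rightUnitor M := Bimod.rightUnitorBimod M
  whiskerLeft_id _ _ := Bimod.whiskerLeft_id_bimod
  id_whiskerRight _ _ := Bimod.id_whiskerRight_bimod
  id_tensorHom_id M N := by
    show Bimod.whiskerRight (𝟙 M) N ≫ Bimod.whiskerLeft M (𝟙 N) = 𝟙 (M.tensorBimod N)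
    rw [Bimod.whiskerLeft_id_bimod, Bimod.id_whiskerRight_bimod, Category.comp_id]
  tensorHom_comp_tensorHom {X₁ Y₁ Z₁ X₂ Y₂ Z₂} f₁ f₂ g₁ g₂ := by
    show (Bimod.whiskerRight f₁ X₂ ≫ Bimod.whiskerLeft Y₁ f₂) ≫
      Bimod.whiskerRight g₁ Y₂ ≫ Bimod.whiskerLeft Z₁ g₂ =
        Bimod.whiskerRight (f₁ ≫ g₁) X₂ ≫ Bimod.whiskerLeft Z₁ (f₂ ≫ g₂)
    rw [Bimod.whiskerLeft_comp_bimod, Bimod.comp_whiskerRight_bimod, Category.assoc,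
      Category.assoc, ← Category.assoc (Bimod.whiskerLeft Y₁ f₂), Bimod.whisker_exchange_bimod,
      Category.assoc]
  associator_naturality {X₁ X₂ X₃ Y₁ Y₂ Y₃} f₁ f₂ f₃ := by
    show (Bimod.whiskerRight (Bimod.whiskerRight f₁ X₂ ≫ Bimod.whiskerLeft Y₁ f₂) X₃ ≫
        Bimod.whiskerLeft (Y₁.tensorBimod Y₂) f₃) ≫ (Bimod.associatorBimod Y₁ Y₂ Y₃).hom =
      (Bimod.associatorBimod X₁ X₂ X₃).hom ≫ Bimod.whiskerRight f₁ (X₂.tensorBimod X₃) ≫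
        Bimod.whiskerLeft Y₁ (Bimod.whiskerRight f₂ X₃ ≫ Bimod.whiskerLeft Y₂ f₃)
    rw [Bimod.comp_whiskerRight_bimod, Bimod.whisker_assoc_bimod, Bimod.whiskerLeft_comp_bimod,
      Bimod.comp_whiskerLeft_bimod, Bimod.whiskerRight_comp_bimod]
    simp
  leftUnitor_naturality {X Y} f := by
    show Bimod.whiskerLeft (Bimod.regular A) f ≫ (Bimod.leftUnitorBimod Y).hom =
      (Bimod.leftUnitorBimod X).hom ≫ f
    rw [Bimod.id_whiskerLeft_bimod]
    simp
  rightUnitor_naturality {X Y} f := by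
    show Bimod.whiskerRight f (Bimod.regular A) ≫ (Bimod.rightUnitorBimod Y).hom =
      (Bimod.rightUnitorBimod X).hom ≫ f
    rw [Bimod.whiskerRight_id_bimod]
    simp
  pentagon K L M N := Bimod.pentagon_bimod K L M N
  triangle M N := Bimod.triangle_bimod M N

end Monoidal

variable (k R : Type u) [Field k] [Ring R] [Algebra k R]

/-- The `k`-algebra `R` as a monoid object in `k`-vector spaces. -/
noncomputable abbrev algObj : Mon (ModuleCat.{u} k) :=
  ModuleCat.MonModuleEquivalenceAlgebra.inverse.obj (AlgCat.of k R)

/-- The category of `R`-bimodules (on which `k` acts centrally). -/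
noncomputable abbrev RBimod := Bimod (algObj k R) (algObj k R)

variable {k R} in
/-- A bimodule is finite-dimensional if its underlying `k`-vector space is. -/
def IsFD : ObjectProperty (RBimod k R) := fun M => FiniteDimensional k M.X

instance [hR : FiniteDimensional k R] : (IsFD (k := k) (R := R)).IsMonoidal where
  prop_unit := hR
  prop_tensor M N hM hN := by
    have : FiniteDimensional k M.X := hM
    have : FiniteDimensional k N.X := hN
    have : FiniteDimensional k (M.X ⊗ N.X : ModuleCat k) :=
      inferInstanceAs (FiniteDimensional k (TensorProduct k M.X N.X))
    let p := Limits.coequalizer.π (M.actRight ▷ N.X) ((α_ _ _ _).hom ≫ (M.X ◁ N.actLeft))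
    exact Module.Finite.of_surjective p.hom ((ModuleCat.epi_iff_surjective p).1 inferInstance)

/-- The left action of `R` on `R* = Hom_k(R, k)`, `(z.f)(y) = f (y * z)`. -/
def dualLeft : R →ₗ[k] Module.Dual k R →ₗ[k] Module.Dual k R :=
  LinearMap.mk₂ k (fun z f => f ∘ₗ LinearMap.mulRight k z)
    (by intros; ext; simp [mul_add]) (by intros; ext; simp) (by intros; ext; simp)
    (by intros; ext; simp)

/-- The right action of `R` on `R* = Hom_k(R, k)`, `(f.x)(y) = f (x * y)`. -/
def dualRight : Module.Dual k R →ₗ[k] R →ₗ[k] Module.Dual k R :=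
  LinearMap.mk₂ k (fun f x => f ∘ₗ LinearMap.mulLeft k x)
    (by intros; ext; simp) (by intros; ext; simp) (by intros; ext; simp [add_mul])
    (by intros; ext; simp)

/-- The dual `R`-bimodule `R* = Hom_k(R, k)`, with `(z.f.x)(y) = f (x * y * z)`. -/
noncomputable def dualBimod : RBimod k R where
  X := ModuleCat.of k (Module.Dual k R)
  actLeft := ModuleCat.ofHom (TensorProduct.lift (dualLeft k R))
  actRight := ModuleCat.ofHom (TensorProduct.lift (dualRight k R))
  one_actLeft := by
    ext : 1
    refine TensorProduct.ext' fun (c : k) (f : Module.Dual k R) =>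
      LinearMap.ext fun (y : R) => ?_
    change f (y * algebraMap k R c) = c • f y
    rw [← map_smul, Algebra.smul_def, Algebra.commutes]
  left_assoc := by
    ext : 1
    refine TensorProduct.ext_threefold fun (z z' : R) (f : Module.Dual k R) =>
      LinearMap.ext fun (y : R) => ?_
    change f (y * (z * z')) = f ((y * z) * z')
    rw [mul_assoc]
  actRight_one := by
    ext : 1
    refine TensorProduct.ext' fun (f : Module.Dual k R) (c : k) =>
      LinearMap.ext fun (y : R) => ?_
    change f (algebraMap k R c * y) = c • f y
    rw [← map_smul, Algebra.smul_def]
  right_assoc := by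
    ext : 1
    refine TensorProduct.ext (LinearMap.ext fun (f : Module.Dual k R) =>
      TensorProduct.ext' fun (x x' : R) => LinearMap.ext fun (y : R) => ?_)
    change f ((x * x') * y) = f (x * (x' * y))
    rw [mul_assoc]
  middle_assoc := by
    ext : 1
    refine TensorProduct.ext_threefold fun (z : R) (f : Module.Dual k R) (x : R) =>
      LinearMap.ext fun (y : R) => ?_
    change f ((x * y) * z) = f (x * (y * z))
    rw [mul_assoc]

/-- The dual bimodule `R*` as a finite-dimensional bimodule. -/
noncomputable def dualFD [FiniteDimensional k R] : (IsFD (k := k) (R := R)).FullSubcategory :=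
  ⟨dualBimod k R, inferInstanceAs (FiniteDimensional k (Module.Dual k R))⟩

end Bimodules

/-! ### Hopf algebroids -/

section HopfAlgebroids

variable (k R : Type u) [Field k] [Ring R] [Algebra k R]

/-- An `R`-bialgebroid: a `k`-linear bimonad `T` on the monoidal category of `R`-bimodules that
admits a right adjoint. -/
structure Bialgebroid where
  /-- the monad -/
  T : Monad (RBimod k R)
  /-- its opmonoidal structure -/
  [oplax : T.toFunctor.OplaxMonoidal]
  [bimonad : IsBimonad T]
  [additive : T.toFunctor.Additive]
  [linear : T.toFunctor.Linear k]
  [leftAdjoint : T.toFunctor.IsLeftAdjoint]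

attribute [instance] Bialgebroid.oplax Bialgebroid.bimonad

/-- An `R`-Hopf algebroid: an `R`-bialgebroid whose left and right fusion operators are
invertible. -/
structure HopfAlgebroid extends Bialgebroid k R where
  hopf : IsHopfMonad T

variable {k R} (B : HopfAlgebroid k R) [FiniteDimensional k R]

/-- The monoidal category of finite-dimensional modules over a Hopf algebroid. -/
abbrev FDMod := (moduleProp B.T (IsFD (k := k) (R := R))).FullSubcategory

/-- The forgetful functor from finite-dimensional modules to finite-dimensional bimodules. -/
noncomputable abbrev forgetFD : FDMod B ⥤ (IsFD (k := k) (R := R)).FullSubcategory :=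
  forgetFull B.T IsFD

/-- A module structure on the dual bimodule `R*` over a Hopf algebroid: an action of the monad on
the object `R*`. -/
structure DualModuleStructure where
  /-- the action -/
  act : B.T.obj (dualBimod k R) ⟶ dualBimod k R
  unit : B.T.η.app (dualBimod k R) ≫ act = 𝟙 (dualBimod k R)
  assoc : B.T.μ.app (dualBimod k R) ≫ act = B.T.map act ≫ act

variable {B} in
/-- The dual bimodule `R*` with a given module structure, as a finite-dimensional module. -/
noncomputable def DualModuleStructure.toFDMod (ω : DualModuleStructure B) : FDMod B :=
  ⟨⟨dualBimod k R, ω.act, ω.unit, ω.assoc⟩, (dualFD k R).property⟩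

end HopfAlgebroids

end HopfAlgebroidGV

/-! For bimodules the theorem is linear algebra. A bimodule map e : A ⊗_R B → R* is the same as a
bilinear form on A × B with values in k, namely (a, b) ↦ e(a ⊗ b)(1), satisfying ⟨ar, b⟩ = ⟨a, rb⟩
and ⟨ra, b⟩ = ⟨a, br⟩ (`exists_form_eq`, `pairing_ext`). If the form is perfect over k, then each of
A and B represents the pairings into R* with the other (`isPerfect_of_isPerfPair`). A
finite-dimensional M is perfectly paired, on either side, with its linear dual. So R* is dualizing,
and duality yields internal homs: if Y is dual to W, the dual of X ⊗ W is an internal hom from X to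
Y.

Everything then lifts along the Hopf monad T. For a T-module M the fusion map T(X ⊗ M) → TX ⊗ M is
invertible: on free modules it is a fusion operator, and every module is a split coequalizer of free
ones in the base category (`isIso_of_isIso_free`). An internal hom H from M to N in the base
therefore carries the action transposed from TH ⊗ M ≅ T(H ⊗ M) → TN → N. With it the evaluation is a
module map and is universal among modules (`IsRightHom.of_forget`). So the forgetful functor
preserves evaluations, which is closedness, and any action on R* gives perfect pairings of modules,
hence a dualizing object. -/

namespace HopfAlgebroidGV

/-! ### Internal homs as universal evaluations -/

section InternalHom

variable {C : Type*} [Category* C] [MonoidalCategory C]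

/-- The evaluation `e : H ⊗ X ⟶ Y` exhibits `H` as an internal hom representing
`Hom(- ⊗ X, Y)`. -/
def IsRightHom {H X Y : C} (e : H ⊗ X ⟶ Y) : Prop :=
  ∀ Z : C, Function.Bijective fun f : Z ⟶ H => f ▷ X ≫ e

/-- The evaluation `e : X ⊗ H ⟶ Y` exhibits `H` as an internal hom representing
`Hom(X ⊗ -, Y)`. -/
def IsLeftHom {X H Y : C} (e : X ⊗ H ⟶ Y) : Prop :=
  ∀ Z : C, Function.Bijective fun f : Z ⟶ H => X ◁ f ≫ e

namespace IsRightHom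

variable {H X Y : C} {e : H ⊗ X ⟶ Y}

theorem hom_ext (he : IsRightHom e) {Z : C} {f g : Z ⟶ H} (h : f ▷ X ≫ e = g ▷ X ≫ e) : f = g :=
  (he Z).1 h

theorem exists_lift (he : IsRightHom e) {Z : C} (g : Z ⊗ X ⟶ Y) : ∃ f : Z ⟶ H, f ▷ X ≫ e = g :=
  (he Z).2 g

/-- The morphism `Z ⟶ H` corresponding to `Z ⊗ X ⟶ Y`. -/
noncomputable def lift (he : IsRightHom e) {Z : C} (g : Z ⊗ X ⟶ Y) : Z ⟶ H :=
  (he.exists_lift g).choose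

@[simp]
theorem lift_comp (he : IsRightHom e) {Z : C} (g : Z ⊗ X ⟶ Y) : he.lift g ▷ X ≫ e = g :=
  (he.exists_lift g).choose_spec

theorem isIso_of_comp_eq {H' : C} {e' : H' ⊗ X ⟶ Y} (he : IsRightHom e) (he' : IsRightHom e')
    {g : H ⟶ H'} (hg : g ▷ X ≫ e' = e) : IsIso g :=
  ⟨he.lift e', he.hom_ext (by simp [hg]), he'.hom_ext (by simp [hg])⟩

/-- Two internal homs of the same objects are isomorphic. -/
noncomputable def uniqueIso {H' : C} {e' : H' ⊗ X ⟶ Y} (he : IsRightHom e)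
    (he' : IsRightHom e') : H ≅ H' where
  hom := he'.lift e
  inv := he.lift e'
  hom_inv_id := he.hom_ext (by simp)
  inv_hom_id := he'.hom_ext (by simp)

end IsRightHom

namespace IsLeftHom

variable {H X Y : C} {e : X ⊗ H ⟶ Y}

theorem hom_ext (he : IsLeftHom e) {Z : C} {f g : Z ⟶ H} (h : X ◁ f ≫ e = X ◁ g ≫ e) : f = g :=
  (he Z).1 h

theorem exists_lift (he : IsLeftHom e) {Z : C} (g : X ⊗ Z ⟶ Y) : ∃ f : Z ⟶ H, X ◁ f ≫ e = g :=
  (he Z).2 g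

/-- The morphism `Z ⟶ H` corresponding to `X ⊗ Z ⟶ Y`. -/
noncomputable def lift (he : IsLeftHom e) {Z : C} (g : X ⊗ Z ⟶ Y) : Z ⟶ H :=
  (he.exists_lift g).choose

@[simp]
theorem lift_comp (he : IsLeftHom e) {Z : C} (g : X ⊗ Z ⟶ Y) : X ◁ he.lift g ≫ e = g :=
  (he.exists_lift g).choose_spec

theorem isIso_of_comp_eq {H' : C} {e' : X ⊗ H' ⟶ Y} (he : IsLeftHom e) (he' : IsLeftHom e')
    {g : H ⟶ H'} (hg : X ◁ g ≫ e' = e) : IsIso g :=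
  ⟨he.lift e', he.hom_ext (by simp [hg]), he'.hom_ext (by simp [hg])⟩

end IsLeftHom

/-- Reduces questions about an arbitrary choice of right adjoint to questions about evaluations. -/
theorem isRightHom_counit {X : C} {G : C ⥤ C} (adj : tensorRight X ⊣ G) (Y : C) :
    IsRightHom (H := G.obj Y) (adj.counit.app Y) := fun Z => by
  refine (congrArg Function.Bijective (funext fun f => ?_)).mp (adj.homEquiv Z Y).symm.bijective
  exact adj.homEquiv_counit (g := f)

theorem isLeftHom_counit {X : C} {G : C ⥤ C} (adj : tensorLeft X ⊣ G) (Y : C) :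
    IsLeftHom (H := G.obj Y) (adj.counit.app Y) := fun Z => by
  refine (congrArg Function.Bijective (funext fun f => ?_)).mp (adj.homEquiv Z Y).symm.bijective
  exact adj.homEquiv_counit (g := f)

theorem isLeftAdjoint_tensorRight (X : C)
    (h : ∀ Y : C, ∃ (H : C) (e : H ⊗ X ⟶ Y), IsRightHom e) : (tensorRight X).IsLeftAdjoint := by
  choose H e he using h
  exact (Adjunction.adjunctionOfEquivRight (F := tensorRight X) (G_obj := H)
    (fun Z Y => (Equiv.ofBijective _ (he Y Z)).symm) (fun Z' Z Y f g => by
      rw [Equiv.symm_apply_eq]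
      change f ▷ X ≫ g = (f ≫ _) ▷ X ≫ e Y
      rw [comp_whiskerRight, Category.assoc]
      congr 1
      exact ((Equiv.ofBijective _ (he Y Z)).apply_symm_apply g).symm)).isLeftAdjoint

theorem isLeftAdjoint_tensorLeft (X : C)
    (h : ∀ Y : C, ∃ (H : C) (e : X ⊗ H ⟶ Y), IsLeftHom e) : (tensorLeft X).IsLeftAdjoint := by
  choose H e he using h
  exact (Adjunction.adjunctionOfEquivRight (F := tensorLeft X) (G_obj := H)
    (fun Z Y => (Equiv.ofBijective _ (he Y Z)).symm) (fun Z' Z Y f g => by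
      rw [Equiv.symm_apply_eq]
      change X ◁ f ≫ g = X ◁ (f ≫ _) ≫ e Y
      rw [MonoidalCategory.whiskerLeft_comp, Category.assoc]
      congr 1
      exact ((Equiv.ofBijective _ (he Y Z)).apply_symm_apply g).symm)).isLeftAdjoint

/-- A pairing `A ⊗ B ⟶ K` that exhibits each of `A` and `B` as the `K`-dual of the other one. -/
structure IsPerfect {A B K : C} (e : A ⊗ B ⟶ K) : Prop where
  right : IsRightHom e
  left : IsLeftHom e

/-- If `Y` and `X ⊗ W` have duals, `Y` being dual to `W`, then the dual of `X ⊗ W` is an internal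
hom from `X` to `Y`. -/
theorem exists_isRightHom {X Y W H K : C} {e₁ : Y ⊗ W ⟶ K} (h₁ : IsRightHom e₁)
    {e₂ : H ⊗ X ⊗ W ⟶ K} (h₂ : IsRightHom e₂) : ∃ e : H ⊗ X ⟶ Y, IsRightHom e := by
  refine ⟨h₁.lift ((α_ _ _ _).hom ≫ e₂), fun Z => ?_⟩
  -- The chain is Hom(Z, H) ≅ Hom(Z ⊗ (X ⊗ W), K) ≅ Hom((Z ⊗ X) ⊗ W, K) ≅ Hom(Z ⊗ X, Y). Composing
  -- with the last bijection, given by `h₁`, leaves `h₂` and an associator.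
  refine (Function.Bijective.of_comp_iff' (h₁ (Z ⊗ X)) _).1 ?_
  convert ((α_ Z X W).symm.homFromEquiv (Z := K)).bijective.comp (h₂ Z) using 1
  funext f
  simp

theorem exists_isLeftHom {X Y W H K : C} {e₁ : W ⊗ Y ⟶ K} (h₁ : IsLeftHom e₁)
    {e₂ : (W ⊗ X) ⊗ H ⟶ K} (h₂ : IsLeftHom e₂) : ∃ e : X ⊗ H ⟶ Y, IsLeftHom e := by
  refine ⟨h₁.lift ((α_ _ _ _).inv ≫ e₂), fun Z => ?_⟩
  refine (Function.Bijective.of_comp_iff' (h₁ (X ⊗ Z)) _).1 ?_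
  convert ((α_ W X Z).homFromEquiv (Z := K)).bijective.comp (h₂ Z) using 1
  funext f
  simp

/-! ### Dualizing objects from perfect pairings -/

section Dualizing

variable {K : C} {A : C → C} {e : ∀ Y, A Y ⊗ Y ⟶ K}

/-- The duality functor given by a choice of representing objects. -/
noncomputable def DualityFunctor.ofIsRightHom (he : ∀ Y, IsRightHom (e Y)) : DualityFunctor K where
  D :=
    { obj Y := A Y.unop
      map {Y Y'} h := (he Y'.unop).lift (A Y.unop ◁ h.unop ≫ e Y.unop)
      map_id Y := (he _).hom_ext (by simp)
      map_comp {Y Y' Y''} f g := (he _).hom_ext (by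
        rw [comp_whiskerRight, Category.assoc, IsRightHom.lift_comp, IsRightHom.lift_comp,
          ← whisker_exchange_assoc, IsRightHom.lift_comp, unop_comp,
          MonoidalCategory.whiskerLeft_comp, Category.assoc]) }
  repr Y :=
    { homEquiv := Equiv.ofBijective _ (he Y _)
      homEquiv_comp f g := by simp }
  repr_naturality {X Y Y'} h f := by
    change (f ≫ (he Y').lift _) ▷ Y' ≫ e Y' = X ◁ h ≫ f ▷ Y ≫ e Y
    rw [comp_whiskerRight, Category.assoc, IsRightHom.lift_comp, whisker_exchange_assoc]
    rfl

/-- The right halves of the pairings in `h₁` define D. Their left halves make it fully faithful: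
Hom(Y', Y) ≅ Hom(DY ⊗ Y', K) ≅ Hom(DY, DY'). The pairings in `h₂` make it essentially surjective,
since X and DB represent the same presheaf once X ⊗ B → K is perfect. -/
theorem isDualizing_of_isPerfect (h₁ : ∀ Y : C, ∃ (A : C) (e : A ⊗ Y ⟶ K), IsPerfect e)
    (h₂ : ∀ Y : C, ∃ (B : C) (e : Y ⊗ B ⟶ K), IsPerfect e) : IsDualizing K := by
  choose A e he using h₁
  let 𝔇 := DualityFunctor.ofIsRightHom fun Y => (he Y).right
  have hD {Y Y' : C} (h : Y' ⟶ Y) : 𝔇.D.map h.op ▷ Y' ≫ e Y' = A Y ◁ h ≫ e Y :=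
    (he Y').right.lift_comp _
  refine ⟨𝔇, ?_⟩
  have : 𝔇.D.Faithful := ⟨fun {Y Y'} f g hfg => Quiver.Hom.unop_inj ((he Y.unop).left.hom_ext (by
    rw [← hD, ← hD, Quiver.Hom.op_unop, Quiver.Hom.op_unop, hfg]))⟩
  have : 𝔇.D.Full := ⟨fun {Y Y'} f => by
    obtain ⟨g, hg⟩ := (he Y.unop).left.exists_lift (f ▷ Y'.unop ≫ e Y'.unop)
    exact ⟨g.op, (he Y'.unop).right.hom_ext ((hD g).trans hg)⟩⟩
  have : 𝔇.D.EssSurj := ⟨fun X => by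
    obtain ⟨B, e', he'⟩ := h₂ X
    exact ⟨Opposite.op B, ⟨(he B).right.uniqueIso he'.right⟩⟩⟩
  exact {}

end Dualizing

end InternalHom

/-! ### Lifting internal homs along a Hopf monad -/

section Lifting

variable {C : Type*} [Category* C] [MonoidalCategory C]

open Functor.OplaxMonoidal

variable {T : Monad C} [T.toFunctor.OplaxMonoidal]

/-- The morphism `T (X ⊗ M) ⟶ T X ⊗ M` for a `T`-module `M`. -/
def rightModuleFusion (X : C) (M : T.Algebra) : T.obj (X ⊗ M.A) ⟶ T.obj X ⊗ M.A :=
  δ T.toFunctor X M.A ≫ T.obj X ◁ M.a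

/-- The morphism `T (M ⊗ X) ⟶ M ⊗ T X` for a `T`-module `M`. -/
def leftModuleFusion (M : T.Algebra) (X : C) : T.obj (M.A ⊗ X) ⟶ M.A ⊗ T.obj X :=
  δ T.toFunctor M.A X ≫ M.a ▷ T.obj X

theorem rightModuleFusion_naturality {X X' : C} (f : X ⟶ X') (M : T.Algebra) :
    T.map (f ▷ M.A) ≫ rightModuleFusion X' M = rightModuleFusion X M ≫ T.map f ▷ M.A := by
  simp only [rightModuleFusion, Category.assoc, whisker_exchange]
  rw [← δ_natural_left_assoc]

theorem leftModuleFusion_naturality (M : T.Algebra) {X X' : C} (f : X ⟶ X') :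
    T.map (M.A ◁ f) ≫ leftModuleFusion M X' = leftModuleFusion M X ≫ M.A ◁ T.map f := by
  simp only [leftModuleFusion, Category.assoc, ← whisker_exchange]
  rw [← δ_natural_right_assoc]

theorem rightModuleFusion_naturality_right (X : C) {M N : T.Algebra} (g : M ⟶ N) :
    T.map (X ◁ g.f) ≫ rightModuleFusion X N = rightModuleFusion X M ≫ T.obj X ◁ g.f := by
  simp only [rightModuleFusion, Category.assoc, ← MonoidalCategory.whiskerLeft_comp, ← g.h]
  rw [← δ_natural_right_assoc, MonoidalCategory.whiskerLeft_comp]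

theorem leftModuleFusion_naturality_left {M N : T.Algebra} (g : M ⟶ N) (X : C) :
    T.map (g.f ▷ X) ≫ leftModuleFusion N X = leftModuleFusion M X ≫ g.f ▷ T.obj X := by
  simp only [leftModuleFusion, Category.assoc, ← comp_whiskerRight, ← g.h]
  rw [← δ_natural_left_assoc, comp_whiskerRight]

/-- The action of a module, as a morphism of modules from the free module. -/
def freeAction (M : T.Algebra) : T.free.obj M.A ⟶ M where
  f := M.a
  h := M.assoc.symm

omit [MonoidalCategory C] [T.toFunctor.OplaxMonoidal] in
/-- A family of morphisms that is natural in the modules over a monad consists of isomorphisms if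
it does so on free modules. -/
theorem isIso_of_isIso_free {D : Type*} [Category* D] {F G : C ⥤ D}
    (φ : ∀ M : T.Algebra, F.obj M.A ⟶ G.obj M.A)
    (nat : ∀ {M N : T.Algebra} (g : M ⟶ N), F.map g.f ≫ φ N = φ M ≫ G.map g.f)
    (h : ∀ X : C, IsIso (φ (T.free.obj X))) (M : T.Algebra) : IsIso (φ M) := by
  let φ₀ (X : C) : F.obj (T.obj X) ⟶ G.obj (T.obj X) := φ (T.free.obj X)
  have (X : C) : IsIso (φ₀ X) := h X
  have nat' {X Y : C} (g : T.free.obj X ⟶ T.free.obj Y) {g₀ : T.obj X ⟶ T.obj Y}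
      (hg : g.f = g₀) : G.map g₀ ≫ inv (φ₀ Y) = inv (φ₀ X) ≫ F.map g₀ := by
    rw [IsIso.comp_inv_eq, Category.assoc, IsIso.eq_inv_comp, ← hg]
    exact (nat g).symm
  have ha : F.map M.a ≫ φ M = φ₀ M.A ≫ G.map M.a := nat (freeAction M)
  have hT := nat' (T.free.map M.a) (g₀ := T.map M.a) rfl
  have hμ := nat' (X := T.obj M.A) (freeAction (T.free.obj M.A)) (g₀ := T.μ.app M.A) rfl
  have hη : G.map M.a ≫ G.map (T.η.app M.A) =
      G.map (T.η.app (T.obj M.A)) ≫ G.map (T.map M.a) := by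
    rw [← G.map_comp, ← G.map_comp]
    exact congrArg G.map (T.η.naturality M.a)
  have hF : F.map (T.map M.a) ≫ F.map M.a = F.map (T.μ.app M.A) ≫ F.map M.a := by
    rw [← F.map_comp, ← F.map_comp, M.assoc]
  have hG : G.map (T.η.app (T.obj M.A)) ≫ G.map (T.μ.app M.A) = 𝟙 (G.obj (T.obj M.A)) := by
    rw [← G.map_comp, ← G.map_id]
    exact congrArg G.map (T.left_unit M.A)
  have hunit : G.map (T.η.app M.A) ≫ G.map M.a = 𝟙 (G.obj M.A) := by
    rw [← G.map_comp, ← G.map_id]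
    exact congrArg G.map M.unit
  have : IsSplitEpi M.a := ⟨⟨⟨T.η.app M.A, M.unit⟩⟩⟩
  -- The inverse comes from the splitting of TTM ⇉ TM → M by units. Units are not module maps, so φ
  -- is not natural in them; naturality is applied only to Ta, μ and a, which are.
  refine ⟨G.map (T.η.app M.A) ≫ inv (φ₀ M.A) ≫ F.map M.a, ?_, ?_⟩
  · rw [← cancel_epi (F.map M.a), reassoc_of% ha, reassoc_of% hη, reassoc_of% hT, hF,
      ← reassoc_of% hμ, reassoc_of% hG, IsIso.hom_inv_id_assoc, Category.comp_id]
  · rw [Category.assoc, Category.assoc, ha, IsIso.inv_hom_id_assoc, hunit]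

/-- On a free module this morphism is the right fusion operator. -/
theorem isIso_rightModuleFusion (hT : IsHopfMonad T) (X : C) (M : T.Algebra) :
    IsIso (rightModuleFusion X M) :=
  isIso_of_isIso_free (F := tensorLeft X ⋙ T.toFunctor) (G := tensorLeft (T.obj X))
    (rightModuleFusion X) (rightModuleFusion_naturality_right X) (hT.right X) M

theorem isIso_leftModuleFusion (hT : IsHopfMonad T) (M : T.Algebra) (X : C) :
    IsIso (leftModuleFusion M X) :=
  isIso_of_isIso_free (F := tensorRight X ⋙ T.toFunctor) (G := tensorRight (T.obj X))
    (fun M => leftModuleFusion M X) (fun g => leftModuleFusion_naturality_left g X)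
    (fun Y => hT.left Y X) M

/-- When `f` is a module action, the right side is the action on the tensor product, which thus
factors through an invertible morphism. -/
theorem rightModuleFusion_comp (X : C) (M : T.Algebra) {Y : C} (f : T.obj X ⟶ Y) :
    rightModuleFusion X M ≫ f ▷ M.A = δ T.toFunctor X M.A ≫ (f ⊗ₘ M.a) := by
  rw [rightModuleFusion, Category.assoc, MonoidalCategory.tensorHom_def']

theorem leftModuleFusion_comp (M : T.Algebra) (X : C) {Y : C} (f : T.obj X ⟶ Y) :
    leftModuleFusion M X ≫ M.A ◁ f = δ T.toFunctor M.A X ≫ (M.a ⊗ₘ f) := by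
  rw [leftModuleFusion, Category.assoc, MonoidalCategory.tensorHom_def]

variable [IsBimonad T]

/-- With `mul_rightModuleFusion`, this carries the module axioms of N over to an internal hom into
N. -/
theorem unit_rightModuleFusion (X : C) (M : T.Algebra) :
    T.η.app (X ⊗ M.A) ≫ rightModuleFusion X M =
      (T.η.app X : X ⟶ T.obj X) ▷ M.A := by
  rw [rightModuleFusion, ← Category.assoc, IsBimonad.unit_δ, MonoidalCategory.tensorHom_def,
    Category.assoc, ← MonoidalCategory.whiskerLeft_comp, M.unit]
  exact (congrArg _ (MonoidalCategory.whiskerLeft_id _ _)).trans (Category.comp_id _)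

theorem unit_leftModuleFusion (M : T.Algebra) (X : C) :
    T.η.app (M.A ⊗ X) ≫ leftModuleFusion M X =
      M.A ◁ (T.η.app X : X ⟶ T.obj X) := by
  rw [leftModuleFusion, ← Category.assoc, IsBimonad.unit_δ, MonoidalCategory.tensorHom_def',
    Category.assoc, ← comp_whiskerRight, M.unit]
  exact (congrArg _ (id_whiskerRight _ _)).trans (Category.comp_id _)

theorem mul_rightModuleFusion (X : C) (M : T.Algebra) :
    T.μ.app (X ⊗ M.A) ≫ rightModuleFusion X M =
      T.map (rightModuleFusion X M) ≫ rightModuleFusion (T.obj X) M ≫ T.μ.app X ▷ M.A := by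
  rw [rightModuleFusion_comp, rightModuleFusion, ← Category.assoc, IsBimonad.mul_δ]
  simp only [Category.assoc, Functor.map_comp]
  rw [← δ_natural_right_assoc, ← id_tensorHom, ← id_tensorHom, tensorHom_comp_tensorHom,
    tensorHom_comp_tensorHom, M.assoc, Category.id_comp, Category.comp_id]

theorem mul_leftModuleFusion (M : T.Algebra) (X : C) :
    T.μ.app (M.A ⊗ X) ≫ leftModuleFusion M X =
      T.map (leftModuleFusion M X) ≫ leftModuleFusion M (T.obj X) ≫ M.A ◁ T.μ.app X := by
  rw [leftModuleFusion_comp, leftModuleFusion, ← Category.assoc, IsBimonad.mul_δ]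
  simp only [Category.assoc, Functor.map_comp]
  rw [← δ_natural_left_assoc, ← tensorHom_id, ← tensorHom_id, tensorHom_comp_tensorHom,
    tensorHom_comp_tensorHom, M.assoc, Category.id_comp, Category.comp_id]

/-- An internal hom of the objects underlying two modules over a Hopf monad is a module, in such a
way that the evaluation is a morphism of modules. -/
theorem exists_module_of_isRightHom (hT : IsHopfMonad T) {M N : T.Algebra} {H : C}
    {e : H ⊗ M.A ⟶ N.A} (he : IsRightHom e) :
    ∃ (a : T.obj H ⟶ H) (h₁ : T.η.app H ≫ a = 𝟙 H) (h₂ : T.μ.app H ≫ a = T.map a ≫ a)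
      (ev : (⟨H, a, h₁, h₂⟩ : T.Algebra) ⊗ M ⟶ N), ev.f = e := by
  have hiso (X : C) : IsIso (rightModuleFusion X M) := isIso_rightModuleFusion hT X M
  -- The only action for which `e` is a module map.
  let a : T.obj H ⟶ H := he.lift (inv (rightModuleFusion H M) ≫ T.map e ≫ N.a)
  have ha : rightModuleFusion H M ≫ a ▷ M.A ≫ e = T.map e ≫ N.a := by
    rw [IsRightHom.lift_comp, IsIso.hom_inv_id_assoc]
  refine ⟨a, he.hom_ext (g := 𝟙 H) ?_, he.hom_ext ?_,
    ⟨e, ha.symm.trans (by rw [← Category.assoc, rightModuleFusion_comp]; rfl)⟩, rfl⟩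
  · rw [id_whiskerRight, Category.id_comp]
    refine (comp_whiskerRight_assoc (T.η.app H : H ⟶ T.obj H) a M.A e).trans ?_
    refine ((reassoc_of% unit_rightModuleFusion H M) _).symm.trans ?_
    rw [ha, ← T.η.naturality_assoc e, N.unit]
    exact Category.comp_id e
  -- On T(T(H ⊗ M)) the two sides become μ ≫ Te ≫ N.a and TTe ≫ μ ≫ N.a, equal by naturality of μ.
  · rw [← cancel_epi (rightModuleFusion (T.obj H) M), ← cancel_epi (T.map (rightModuleFusion H M)),
      comp_whiskerRight, Category.assoc, ← reassoc_of% @mul_rightModuleFusion, ha, comp_whiskerRight,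
      Category.assoc, ← reassoc_of% @rightModuleFusion_naturality, ha, ← T.map_comp_assoc,
      ← T.map_comp_assoc, Category.assoc, ha, T.map_comp_assoc, ← N.assoc]
    exact (T.μ.naturality_assoc e N.a).symm

theorem exists_module_of_isLeftHom (hT : IsHopfMonad T) {M N : T.Algebra} {H : C}
    {e : M.A ⊗ H ⟶ N.A} (he : IsLeftHom e) :
    ∃ (a : T.obj H ⟶ H) (h₁ : T.η.app H ≫ a = 𝟙 H) (h₂ : T.μ.app H ≫ a = T.map a ≫ a)
      (ev : M ⊗ (⟨H, a, h₁, h₂⟩ : T.Algebra) ⟶ N), ev.f = e := by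
  have hiso (X : C) : IsIso (leftModuleFusion M X) := isIso_leftModuleFusion hT M X
  let a : T.obj H ⟶ H := he.lift (inv (leftModuleFusion M H) ≫ T.map e ≫ N.a)
  have ha : leftModuleFusion M H ≫ M.A ◁ a ≫ e = T.map e ≫ N.a := by
    rw [IsLeftHom.lift_comp, IsIso.hom_inv_id_assoc]
  refine ⟨a, he.hom_ext (g := 𝟙 H) ?_, he.hom_ext ?_,
    ⟨e, ha.symm.trans (by rw [← Category.assoc, leftModuleFusion_comp]; rfl)⟩, rfl⟩
  · rw [MonoidalCategory.whiskerLeft_id, Category.id_comp]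
    refine (MonoidalCategory.whiskerLeft_comp_assoc M.A (T.η.app H : H ⟶ T.obj H) a e).trans ?_
    refine ((reassoc_of% unit_leftModuleFusion M H) _).symm.trans ?_
    rw [ha, ← T.η.naturality_assoc e, N.unit]
    exact Category.comp_id e
  · rw [← cancel_epi (leftModuleFusion M (T.obj H)), ← cancel_epi (T.map (leftModuleFusion M H)),
      MonoidalCategory.whiskerLeft_comp, Category.assoc, ← reassoc_of% @mul_leftModuleFusion, ha,
      MonoidalCategory.whiskerLeft_comp, Category.assoc,
      ← reassoc_of% @leftModuleFusion_naturality, ha, ← T.map_comp_assoc, ← T.map_comp_assoc, Category.assoc, ha, T.map_comp_assoc, ← N.assoc]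
    exact (T.μ.naturality_assoc e N.a).symm

theorem rightModuleFusion_comp_hom {L M N : T.Algebra} (e : L ⊗ M ⟶ N) {e₀ : L.A ⊗ M.A ⟶ N.A}
    (h : e.f = e₀) : rightModuleFusion L.A M ≫ L.a ▷ M.A ≫ e₀ = T.map e₀ ≫ N.a := by
  rw [← Category.assoc, rightModuleFusion_comp, ← h]
  exact e.h.symm

theorem leftModuleFusion_comp_hom {L M N : T.Algebra} (e : M ⊗ L ⟶ N) {e₀ : M.A ⊗ L.A ⟶ N.A}
    (h : e.f = e₀) : leftModuleFusion M L.A ≫ M.A ◁ L.a ≫ e₀ = T.map e₀ ≫ N.a := by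
  rw [← Category.assoc, leftModuleFusion_comp, ← h]
  exact e.h.symm

/-- The lift f of a module map g in the base category is automatically equivariant: tested against
the evaluation and precomposed with the fusion isomorphism, both sides of the equation become Tg
followed by the action of N. -/
theorem IsRightHom.of_forget (hT : IsHopfMonad T) {L M N : T.Algebra} {e : L ⊗ M ⟶ N}
    {e₀ : L.A ⊗ M.A ⟶ N.A} (he : IsRightHom e₀) (h : e.f = e₀) : IsRightHom e := fun Z => by
  have hiso := isIso_rightModuleFusion hT Z.A M
  subst h
  refine ⟨fun f g hfg => Monad.Algebra.Hom.ext (he.hom_ext (congrArg Monad.Algebra.Hom.f hfg)),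
    fun g => ?_⟩
  obtain ⟨g₀, hg⟩ : ∃ g₀ : Z.A ⊗ M.A ⟶ N.A, g.f = g₀ := ⟨_, rfl⟩
  obtain ⟨f, hf⟩ := he.exists_lift g₀
  refine ⟨⟨f, he.hom_ext ?_⟩, Monad.Algebra.Hom.ext (hf.trans hg.symm)⟩
  obtain ⟨e₀, he₀⟩ : ∃ e₀ : L.A ⊗ M.A ⟶ N.A, e.f = e₀ := ⟨_, rfl⟩
  rw [he₀] at hf ⊢
  rw [← cancel_epi (rightModuleFusion Z.A M), comp_whiskerRight, Category.assoc,
    ← reassoc_of% @rightModuleFusion_naturality, rightModuleFusion_comp_hom e he₀, comp_whiskerRight,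
    Category.assoc, hf, ← T.map_comp_assoc, hf, rightModuleFusion_comp_hom g hg]

theorem IsLeftHom.of_forget (hT : IsHopfMonad T) {L M N : T.Algebra} {e : M ⊗ L ⟶ N}
    {e₀ : M.A ⊗ L.A ⟶ N.A} (he : IsLeftHom e₀) (h : e.f = e₀) : IsLeftHom e := fun Z => by
  have hiso := isIso_leftModuleFusion hT M Z.A
  subst h
  refine ⟨fun f g hfg => Monad.Algebra.Hom.ext (he.hom_ext (congrArg Monad.Algebra.Hom.f hfg)),
    fun g => ?_⟩
  obtain ⟨g₀, hg⟩ : ∃ g₀ : M.A ⊗ Z.A ⟶ N.A, g.f = g₀ := ⟨_, rfl⟩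
  obtain ⟨f, hf⟩ := he.exists_lift g₀
  refine ⟨⟨f, he.hom_ext ?_⟩, Monad.Algebra.Hom.ext (hf.trans hg.symm)⟩
  obtain ⟨e₀, he₀⟩ : ∃ e₀ : M.A ⊗ L.A ⟶ N.A, e.f = e₀ := ⟨_, rfl⟩
  rw [he₀] at hf ⊢
  rw [← cancel_epi (leftModuleFusion M Z.A), MonoidalCategory.whiskerLeft_comp, Category.assoc,
    ← reassoc_of% @leftModuleFusion_naturality, leftModuleFusion_comp_hom e he₀,
    MonoidalCategory.whiskerLeft_comp, Category.assoc, hf, ← T.map_comp_assoc, hf,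
    leftModuleFusion_comp_hom g hg]

end Lifting

/-! ### Bimodules and their tensor products in terms of elements -/

section BimoduleElements

open TensorProduct

variable {k R : Type u} [Field k] [Ring R] [Algebra k R]

namespace RBimod

/-- The left action of `R` on an `R`-bimodule. -/
noncomputable def lact (M : RBimod k R) : R →ₗ[k] M.X →ₗ[k] M.X :=
  TensorProduct.curry (M := R) (N := M.X) M.actLeft.hom

/-- The right action of `R` on an `R`-bimodule. -/
noncomputable def ract (M : RBimod k R) : M.X →ₗ[k] R →ₗ[k] M.X :=
  TensorProduct.curry (M := M.X) (N := R) M.actRight.hom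

section Actions

variable (M : RBimod k R)

theorem lact_one (m : M.X) : lact M 1 m = m := by
  have h := LinearMap.congr_fun (ModuleCat.hom_ext_iff.1 M.one_actLeft) ((1 : k) ⊗ₜ[k] m)
  change lact M (algebraMap k R 1) m = (1 : k) • m at h
  rwa [map_one, one_smul] at h

theorem lact_mul (r s : R) (m : M.X) : lact M (r * s) m = lact M r (lact M s m) :=
  LinearMap.congr_fun (ModuleCat.hom_ext_iff.1 M.left_assoc) ((r ⊗ₜ[k] s) ⊗ₜ[k] m)

theorem ract_one (m : M.X) : ract M m 1 = m := by
  have h := LinearMap.congr_fun (ModuleCat.hom_ext_iff.1 M.actRight_one) (m ⊗ₜ[k] (1 : k))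
  change ract M m (algebraMap k R 1) = (1 : k) • m at h
  rwa [map_one, one_smul] at h

theorem ract_mul (m : M.X) (r s : R) : ract M m (r * s) = ract M (ract M m r) s :=
  LinearMap.congr_fun (ModuleCat.hom_ext_iff.1 M.right_assoc) (m ⊗ₜ[k] (r ⊗ₜ[k] s))

theorem ract_lact (r : R) (m : M.X) (s : R) :
    ract M (lact M r m) s = lact M r (ract M m s) :=
  LinearMap.congr_fun (ModuleCat.hom_ext_iff.1 M.middle_assoc) ((r ⊗ₜ[k] m) ⊗ₜ[k] s)

end Actions

section Hom

variable {M N : RBimod k R}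

theorem hom_lact (f : M ⟶ N) (r : R) (m : M.X) :
    f.hom.hom (lact M r m) = lact N r (f.hom.hom m) :=
  LinearMap.congr_fun (ModuleCat.hom_ext_iff.1 f.left_act_hom) (r ⊗ₜ[k] m)

theorem hom_ract (f : M ⟶ N) (m : M.X) (r : R) :
    f.hom.hom (ract M m r) = ract N (f.hom.hom m) r :=
  LinearMap.congr_fun (ModuleCat.hom_ext_iff.1 f.right_act_hom) (m ⊗ₜ[k] r)

/-- A linear map that commutes with both actions, as a morphism of bimodules. -/
noncomputable def homMk (f : M.X →ₗ[k] N.X) (hl : ∀ r m, f (lact M r m) = lact N r (f m))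
    (hr : ∀ m r, f (ract M m r) = ract N (f m) r) : M ⟶ N where
  hom := ModuleCat.ofHom f
  left_act_hom := by
    ext : 1
    exact TensorProduct.ext' fun (r : R) (m : M.X) => hl r m
  right_act_hom := by
    ext : 1
    exact TensorProduct.ext' fun (m : M.X) (r : R) => hr m r

end Hom

section Tensor

variable (A B : RBimod k R)

/-- Pure tensors in the tensor product of bimodules. -/
noncomputable def tmul : A.X →ₗ[k] B.X →ₗ[k] (A ⊗ B : RBimod k R).X :=
  TensorProduct.curry (M := A.X) (N := B.X)
    (Limits.coequalizer.π (A.actRight ▷ B.X) ((α_ _ _ _).hom ≫ (A.X ◁ B.actLeft))).hom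

theorem tmul_ract (a : A.X) (r : R) (b : B.X) :
    tmul A B (ract A a r) b = tmul A B a (lact B r b) :=
  LinearMap.congr_fun (ModuleCat.hom_ext_iff.1 (Limits.coequalizer.condition
    (A.actRight ▷ B.X) ((α_ _ _ _).hom ≫ (A.X ◁ B.actLeft)))) ((a ⊗ₜ[k] r) ⊗ₜ[k] b)

theorem lact_tmul (r : R) (a : A.X) (b : B.X) :
    lact (A ⊗ B) r (tmul A B a b) = tmul A B (lact A r a) b :=
  LinearMap.congr_fun (ModuleCat.hom_ext_iff.1 (Bimod.TensorBimod.whiskerLeft_π_actLeft A B))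
    (r ⊗ₜ[k] (a ⊗ₜ[k] b))

theorem ract_tmul (a : A.X) (b : B.X) (r : R) :
    ract (A ⊗ B) (tmul A B a b) r = tmul A B a (ract B b r) :=
  LinearMap.congr_fun (ModuleCat.hom_ext_iff.1 (Bimod.TensorBimod.π_tensor_id_actRight A B))
    ((a ⊗ₜ[k] b) ⊗ₜ[k] r)

variable {A B}

theorem linearMap_ext {V : Type*} [AddCommGroup V] [Module k V]
    {f g : (A ⊗ B : RBimod k R).X →ₗ[k] V}
    (h : ∀ a b, f (tmul A B a b) = g (tmul A B a b)) : f = g := by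
  have hπ : Function.Surjective (Limits.coequalizer.π (A.actRight ▷ B.X)
      ((α_ _ _ _).hom ≫ (A.X ◁ B.actLeft))).hom :=
    (ModuleCat.epi_iff_surjective _).1 inferInstance
  exact (LinearMap.cancel_right hπ).1 (TensorProduct.ext' h)

theorem tensor_hom_ext {K : RBimod k R} {f g : A ⊗ B ⟶ K}
    (h : ∀ a b, f.hom.hom (tmul A B a b) = g.hom.hom (tmul A B a b)) : f = g :=
  Bimod.hom_ext _ _ (ModuleCat.hom_ext (linearMap_ext h))

theorem whiskerRight_tmul {A' : RBimod k R} (f : A ⟶ A') (a : A.X) (b : B.X) :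
    (f ▷ B).hom.hom (tmul A B a b) = tmul A' B (f.hom.hom a) b :=
  have h : Limits.coequalizer.π (A.actRight ▷ B.X) ((α_ _ _ _).hom ≫ (A.X ◁ B.actLeft)) ≫
      (Bimod.whiskerRight f B).hom = f.hom ▷ B.X ≫
        Limits.coequalizer.π (A'.actRight ▷ B.X) ((α_ _ _ _).hom ≫ (A'.X ◁ B.actLeft)) :=
    Limits.ι_colimMap _ _
  LinearMap.congr_fun (ModuleCat.hom_ext_iff.1 h) (a ⊗ₜ[k] b)

theorem whiskerLeft_tmul {B' : RBimod k R} (f : B ⟶ B') (a : A.X) (b : B.X) :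
    (A ◁ f).hom.hom (tmul A B a b) = tmul A B' a (f.hom.hom b) :=
  have h : Limits.coequalizer.π (A.actRight ▷ B.X) ((α_ _ _ _).hom ≫ (A.X ◁ B.actLeft)) ≫
      (Bimod.whiskerLeft A f).hom = A.X ◁ f.hom ≫
        Limits.coequalizer.π (A.actRight ▷ B'.X) ((α_ _ _ _).hom ≫ (A.X ◁ B'.actLeft)) :=
    Limits.ι_colimMap _ _
  LinearMap.congr_fun (ModuleCat.hom_ext_iff.1 h) (a ⊗ₜ[k] b)

/-- The linear map from a tensor product of bimodules given by a balanced bilinear map. -/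
theorem exists_linearMap_tmul {V : Type u} [AddCommGroup V] [Module k V]
    (β : A.X →ₗ[k] B.X →ₗ[k] V) (hβ : ∀ a r b, β (ract A a r) b = β a (lact B r b)) :
    ∃ f : (A ⊗ B : RBimod k R).X →ₗ[k] V, ∀ a b, f (tmul A B a b) = β a b := by
  let g : (A.X ⊗ B.X : ModuleCat k) ⟶ ModuleCat.of k V := ModuleCat.ofHom (TensorProduct.lift β)
  have hg : A.actRight ▷ B.X ≫ g = ((α_ _ _ _).hom ≫ A.X ◁ B.actLeft) ≫ g := by
    ext : 1
    exact TensorProduct.ext_threefold fun (a : A.X) (r : R) (b : B.X) => hβ a r b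
  exact ⟨(Limits.coequalizer.desc g hg).hom, fun a b =>
    LinearMap.congr_fun (ModuleCat.hom_ext_iff.1 (Limits.coequalizer.π_desc g hg)) (a ⊗ₜ[k] b)⟩

end Tensor

/-! ### Pairings with values in R* as bilinear forms -/

section Pairing

variable {A B : RBimod k R}

theorem lact_dualBimod (r : R) (f : (dualBimod k R).X) (y : R) :
    (show Module.Dual k R from lact (dualBimod k R) r f) y = (show Module.Dual k R from f) (y * r) :=
  rfl

theorem ract_dualBimod (f : (dualBimod k R).X) (r y : R) :
    (show Module.Dual k R from ract (dualBimod k R) f r) y = (show Module.Dual k R from f) (r * y) :=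
  rfl

/-- The bilinear form `(a, b) ↦ e (a ⊗ b) 1` attached to a pairing with values in `R*`. -/
noncomputable def form (e : A ⊗ B ⟶ dualBimod k R) : A.X →ₗ[k] B.X →ₗ[k] k :=
  (tmul A B).compr₂ ((LinearMap.applyₗ (R := k) (M := R) (M₂ := k) 1) ∘ₗ
    (show (A ⊗ B : RBimod k R).X →ₗ[k] Module.Dual k R from e.hom.hom))

variable (e : A ⊗ B ⟶ dualBimod k R)

/-- Left linearity of `e` and φ(y) = (y.φ)(1) for φ in R*. Hence the form determines the pairing. -/
theorem pairing_apply (a : A.X) (b : B.X) (y : R) :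
    (show Module.Dual k R from e.hom.hom (tmul A B a b)) y = form e (lact A y a) b := by
  change _ = (show Module.Dual k R from e.hom.hom (tmul A B (lact A y a) b)) 1
  rw [← lact_tmul, hom_lact, lact_dualBimod, one_mul]

theorem form_ract (a : A.X) (r : R) (b : B.X) :
    form e (ract A a r) b = form e a (lact B r b) := by
  change (show Module.Dual k R from e.hom.hom (tmul A B (ract A a r) b)) 1 = _
  rw [tmul_ract]
  rfl

/-- Both sides equal e(a ⊗ b)(r), because (r.φ)(1) = φ(r) = (φ.r)(1) in R*. -/
theorem form_lact (r : R) (a : A.X) (b : B.X) :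
    form e (lact A r a) b = form e a (ract B b r) := by
  rw [← pairing_apply]
  change _ = (show Module.Dual k R from e.hom.hom (tmul A B a (ract B b r))) 1
  rw [← ract_tmul, hom_ract, ract_dualBimod, mul_one]

variable {e} in
theorem pairing_ext {e' : A ⊗ B ⟶ dualBimod k R} (h : ∀ a b, form e a b = form e' a b) :
    e = e' :=
  tensor_hom_ext fun a b => LinearMap.ext (M := R) fun y =>
    (pairing_apply e a b y).trans ((h _ _).trans (pairing_apply e' a b y).symm)

theorem form_whiskerRight {A' : RBimod k R} (f : A' ⟶ A) (a : A'.X) (b : B.X) :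
    form (f ▷ B ≫ e) a b = form e (f.hom.hom a) b := by
  change (show Module.Dual k R from e.hom.hom ((f ▷ B).hom.hom (tmul A' B a b))) 1 = _
  rw [whiskerRight_tmul]
  rfl

theorem form_whiskerLeft {B' : RBimod k R} (f : B' ⟶ B) (a : A.X) (b : B'.X) :
    form (A ◁ f ≫ e) a b = form e a (f.hom.hom b) := by
  change (show Module.Dual k R from e.hom.hom ((A ◁ f).hom.hom (tmul A B' a b))) 1 = _
  rw [whiskerLeft_tmul]
  rfl

variable {e}

/-- Perfection identifies A with the linear dual of B, so a form on Z × B is a unique linear map Z →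
A. The forms of both pairings obey the same rules for the actions, so nondegeneracy forces this map
to be a bimodule map. -/
theorem isRightHom_of_isPerfPair (he : (form e).IsPerfPair) : IsRightHom e := fun Z => by
  have inj {a a' : A.X} (h : ∀ b, form e a b = form e a' b) : a = a' :=
    he.bijective_left.1 (LinearMap.ext h)
  refine ⟨fun f g hfg => Bimod.hom_ext _ _ (ModuleCat.hom_ext (LinearMap.ext fun z =>
    inj fun b => ?_)), fun g => ?_⟩
  · rw [← form_whiskerRight, ← form_whiskerRight]
    exact congrArg (fun e' => form e' z b) hfg
  · let f : Z.X →ₗ[k] A.X := (form e).toPerfPair.symm.toLinearMap ∘ₗ form g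
    have hf (z : Z.X) (b : B.X) : form e (f z) b = form g z b :=
      LinearMap.congr_fun ((form e).apply_symm_toPerfPair_self (form g z)) b
    refine ⟨homMk f (fun r z => inj fun b => ?_) (fun z r => inj fun b => ?_),
      pairing_ext fun z b => ?_⟩
    · rw [hf, form_lact, form_lact, hf]
    · rw [hf, form_ract, form_ract, hf]
    · exact (form_whiskerRight e _ z b).trans (hf z b)

theorem isLeftHom_of_isPerfPair (he : (form e).IsPerfPair) : IsLeftHom e := fun Z => by
  have inj {b b' : B.X} (h : ∀ a, form e a b = form e a b') : b = b' :=
    he.bijective_right.1 (LinearMap.ext h)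
  refine ⟨fun f g hfg => Bimod.hom_ext _ _ (ModuleCat.hom_ext (LinearMap.ext fun z =>
    inj fun a => ?_)), fun g => ?_⟩
  · rw [← form_whiskerLeft, ← form_whiskerLeft]
    exact congrArg (fun e' => form e' a z) hfg
  · let f : Z.X →ₗ[k] B.X := (form e).flip.toPerfPair.symm.toLinearMap ∘ₗ (form g).flip
    have hf (a : A.X) (z : Z.X) : form e a (f z) = form g a z :=
      LinearMap.congr_fun ((form e).flip.apply_symm_toPerfPair_self ((form g).flip z)) a
    refine ⟨homMk f (fun r z => inj fun a => ?_) (fun z r => inj fun a => ?_),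
      pairing_ext fun a z => ?_⟩
    · rw [hf, ← form_ract, ← form_ract, hf]
    · rw [hf, ← form_lact, ← form_lact, hf]
    · exact (form_whiskerLeft e _ a z).trans (hf a z)

theorem isPerfect_of_isPerfPair (he : (form e).IsPerfPair) : IsPerfect e :=
  ⟨isRightHom_of_isPerfPair he, isLeftHom_of_isPerfPair he⟩

/-- Every bilinear form compatible with the actions comes from a pairing with values in `R*`. -/
theorem exists_form_eq (β : A.X →ₗ[k] B.X →ₗ[k] k)
    (hr : ∀ a r b, β (ract A a r) b = β a (lact B r b))
    (hl : ∀ r a b, β (lact A r a) b = β a (ract B b r)) :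
    ∃ e : A ⊗ B ⟶ dualBimod k R, form e = β := by
  -- The value y ↦ β(ya, b) is forced by `pairing_apply`.
  let γ : A.X →ₗ[k] B.X →ₗ[k] Module.Dual k R := LinearMap.mk₂ k
    (fun a b => β.flip b ∘ₗ (lact A).flip a)
    (fun a a' b => by ext; simp) (fun c a b => by ext; simp)
    (fun a b b' => by ext; simp) (fun c a b => by ext; simp)
  have hγ (a : A.X) (b : B.X) (y : R) : γ a b y = β (lact A y a) b := rfl
  obtain ⟨φ, hφ⟩ := exists_linearMap_tmul γ fun a r b => LinearMap.ext fun y => by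
    rw [hγ, hγ, ← ract_lact, hr]
  let e : A ⊗ B ⟶ dualBimod k R := homMk (N := dualBimod k R) φ
    (fun r x => by
      have : φ ∘ₗ lact (A ⊗ B) r = lact (dualBimod k R) r ∘ₗ φ := linearMap_ext fun a b => by
        refine LinearMap.ext (M := R) fun y => ?_
        change φ (lact (A ⊗ B) r (tmul A B a b)) y = φ (tmul A B a b) (y * r)
        rw [lact_tmul, hφ, hφ, hγ, hγ, lact_mul]
      exact LinearMap.congr_fun this x)
    (fun x r => by
      have : φ ∘ₗ (ract (A ⊗ B)).flip r = (ract (dualBimod k R)).flip r ∘ₗ φ :=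
        linearMap_ext fun a b => by
          refine LinearMap.ext (M := R) fun y => ?_
          change φ (ract (A ⊗ B) (tmul A B a b) r) y = φ (tmul A B a b) (r * y)
          rw [ract_tmul, hφ, hφ, hγ, hγ, lact_mul, hl r]
      exact LinearMap.congr_fun this x)
  refine ⟨e, LinearMap.ext fun a => LinearMap.ext fun b => ?_⟩
  change φ (tmul A B a b) 1 = _
  rw [hφ, hγ, lact_one]

end Pairing

/-! ### The linear dual as two-sided dual -/

section Dual

variable (M : RBimod k R)

/-- The linear dual of a bimodule. -/
noncomputable def linearDual : RBimod k R where
  X := ModuleCat.of k (Module.Dual k M.X)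
  actLeft := ModuleCat.ofHom (TensorProduct.lift (show R →ₗ[k] Module.Dual k M.X →ₗ[k]
    Module.Dual k M.X from LinearMap.mk₂ k (fun r f => f ∘ₗ (ract M).flip r)
      (by intros; ext; simp) (by intros; ext; simp) (by intros; ext; simp)
      (by intros; ext; simp)))
  actRight := ModuleCat.ofHom (TensorProduct.lift (show Module.Dual k M.X →ₗ[k] R →ₗ[k]
    Module.Dual k M.X from LinearMap.mk₂ k (fun f r => f ∘ₗ lact M r)
      (by intros; ext; simp) (by intros; ext; simp) (by intros; ext; simp)
      (by intros; ext; simp)))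
  one_actLeft := by
    ext : 1
    refine TensorProduct.ext' fun (c : k) (f : Module.Dual k M.X) =>
      LinearMap.ext fun (m : M.X) => ?_
    change f (ract M m (algebraMap k R c)) = c • f m
    rw [Algebra.algebraMap_eq_smul_one, map_smul, ract_one, map_smul]
  left_assoc := by
    ext : 1
    refine TensorProduct.ext_threefold fun (r s : R) (f : Module.Dual k M.X) =>
      LinearMap.ext fun (m : M.X) => ?_
    exact congrArg f (ract_mul M m r s)
  actRight_one := by
    ext : 1
    refine TensorProduct.ext' fun (f : Module.Dual k M.X) (c : k) =>
      LinearMap.ext fun (m : M.X) => ?_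
    change f (lact M (algebraMap k R c) m) = c • f m
    rw [Algebra.algebraMap_eq_smul_one, map_smul, LinearMap.smul_apply, lact_one, map_smul]
  right_assoc := by
    ext : 1
    refine TensorProduct.ext (LinearMap.ext fun (f : Module.Dual k M.X) =>
      TensorProduct.ext' fun (r s : R) => LinearMap.ext fun (m : M.X) => ?_)
    exact congrArg f (lact_mul M r s m)
  middle_assoc := by
    ext : 1
    refine TensorProduct.ext_threefold fun (r : R) (f : Module.Dual k M.X) (s : R) =>
      LinearMap.ext fun (m : M.X) => ?_
    exact congrArg f (ract_lact M s m r)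

/-- The actions on the dual are the transposes, so the evaluation form is compatible by definition;
it is perfect by finite dimension. -/
theorem exists_isPerfect_linearDual_left [FiniteDimensional k M.X] :
    ∃ e : linearDual M ⊗ M ⟶ dualBimod k R, IsPerfect e := by
  obtain ⟨e, he⟩ := exists_form_eq (A := linearDual M) (B := M)
    (LinearMap.id (R := k) (M := Module.Dual k M.X)) (fun _ _ _ => rfl) (fun _ _ _ => rfl)
  exact ⟨e, isPerfect_of_isPerfPair (he ▸ LinearMap.IsPerfPair.id)⟩

theorem exists_isPerfect_linearDual_right [FiniteDimensional k M.X] :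
    ∃ e : M ⊗ linearDual M ⟶ dualBimod k R, IsPerfect e := by
  obtain ⟨e, he⟩ := exists_form_eq (A := M) (B := linearDual M)
    (Module.Dual.eval k M.X) (fun _ _ _ => rfl) (fun _ _ _ => rfl)
  exact ⟨e, isPerfect_of_isPerfPair (he ▸ LinearMap.IsPerfPair.dualEval)⟩

theorem isFD_linearDual {M : RBimod k R} (hM : IsFD M) : IsFD (linearDual M) :=
  have : FiniteDimensional k M.X := hM
  inferInstanceAs (FiniteDimensional k (Module.Dual k M.X))

end Dual

end RBimod

end BimoduleElements

/-! ### Invertibility of internal hom comparators -/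

section Comparators

variable {C : Type*} [Category* C] [MonoidalCategory C]
  {D : Type*} [Category* D] [MonoidalCategory D] (F : C ⥤ D) [F.LaxMonoidal]

open Functor.LaxMonoidal

/-- It suffices that `F` preserves one universal evaluation: precomposed with the image of H ≅ GY,
the comparator becomes the comparison map between two universal evaluations. -/
theorem isIso_rightComparator {X Y H : C} {e : H ⊗ X ⟶ Y} (he : IsRightHom e)
    (hFe : IsRightHom (μ F H X ≫ F.map e)) {G : C ⥤ C} (adj : tensorRight X ⊣ G)
    {G' : D ⥤ D} (adj' : tensorRight (F.obj X) ⊣ G') : IsIso (rightComparator F adj adj' Y) := by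
  obtain ⟨g, hg⟩ := (isRightHom_counit adj Y).exists_lift e
  have := he.isIso_of_comp_eq (isRightHom_counit adj Y) hg
  have hc : rightComparator F adj adj' Y ▷ F.obj X ≫ adj'.counit.app (F.obj Y) =
      μ F (G.obj Y) X ≫ F.map (adj.counit.app Y) :=
    (adj'.homEquiv_counit (g := rightComparator F adj adj' Y)).symm.trans
      ((adj'.homEquiv _ _).symm_apply_apply _)
  have : IsIso (F.map g ≫ rightComparator F adj adj' Y) := by
    refine hFe.isIso_of_comp_eq (isRightHom_counit adj' (F.obj Y)) ?_
    rw [← hg, comp_whiskerRight, Category.assoc, F.map_comp, ← μ_natural_left_assoc]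
    exact congrArg _ hc
  exact IsIso.of_isIso_comp_left (F.map g) _

theorem isIso_leftComparator {X Y H : C} {e : X ⊗ H ⟶ Y} (he : IsLeftHom e)
    (hFe : IsLeftHom (μ F X H ≫ F.map e)) {G : C ⥤ C} (adj : tensorLeft X ⊣ G)
    {G' : D ⥤ D} (adj' : tensorLeft (F.obj X) ⊣ G') : IsIso (leftComparator F adj adj' Y) := by
  obtain ⟨g, hg⟩ := (isLeftHom_counit adj Y).exists_lift e
  have := he.isIso_of_comp_eq (isLeftHom_counit adj Y) hg
  have hc : F.obj X ◁ leftComparator F adj adj' Y ≫ adj'.counit.app (F.obj Y) =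
      μ F X (G.obj Y) ≫ F.map (adj.counit.app Y) :=
    (adj'.homEquiv_counit (g := leftComparator F adj adj' Y)).symm.trans
      ((adj'.homEquiv _ _).symm_apply_apply _)
  have : IsIso (F.map g ≫ leftComparator F adj adj' Y) := by
    refine hFe.isIso_of_comp_eq (isLeftHom_counit adj' (F.obj Y)) ?_
    rw [← hg, MonoidalCategory.whiskerLeft_comp, Category.assoc, F.map_comp,
      ← μ_natural_right_assoc]
    exact congrArg _ hc
  exact IsIso.of_isIso_comp_left (F.map g) _

end Comparators

/-! ### Restriction to full monoidal subcategories -/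

section FullSubcategory

variable {C : Type*} [Category* C] [MonoidalCategory C] {P : ObjectProperty C} [P.IsMonoidal]
  {A X Y : P.FullSubcategory}

theorem IsRightHom.fullSubcategory {e : A ⊗ X ⟶ Y} {e₀ : A.obj ⊗ X.obj ⟶ Y.obj}
    (he : IsRightHom e₀) (h : e.hom = e₀) : IsRightHom e := fun Z => by
  subst h
  exact ⟨fun f g hfg => ObjectProperty.hom_ext _ (he.hom_ext (congrArg (·.hom) hfg)), fun g =>
    ⟨ObjectProperty.homMk (he.lift (Z := Z.obj) g.hom),
      ObjectProperty.hom_ext _ (he.lift_comp (Z := Z.obj) g.hom)⟩⟩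

theorem IsLeftHom.fullSubcategory {e : X ⊗ A ⟶ Y} {e₀ : X.obj ⊗ A.obj ⟶ Y.obj}
    (he : IsLeftHom e₀) (h : e.hom = e₀) : IsLeftHom e := fun Z => by
  subst h
  exact ⟨fun f g hfg => ObjectProperty.hom_ext _ (he.hom_ext (congrArg (·.hom) hfg)), fun g =>
    ⟨ObjectProperty.homMk (he.lift (Z := Z.obj) g.hom),
      ObjectProperty.hom_ext _ (he.lift_comp (Z := Z.obj) g.hom)⟩⟩

theorem IsPerfect.fullSubcategory {e : A ⊗ X ⟶ Y} {e₀ : A.obj ⊗ X.obj ⟶ Y.obj}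
    (he : IsPerfect e₀) (h : e.hom = e₀) : IsPerfect e :=
  ⟨he.right.fullSubcategory h, he.left.fullSubcategory h⟩

end FullSubcategory

/-! ### The forgetful functor of a Hopf monad -/

section ForgetFull

variable {C : Type*} [Category* C] [MonoidalCategory C] {T : Monad C}
  [T.toFunctor.OplaxMonoidal] [IsBimonad T] {P : ObjectProperty C} [P.IsMonoidal]

theorem isStrictMonoidal_forgetFull : IsStrictMonoidal (forgetFull T P) where
  obj_unit := rfl
  obj_tensor _ _ := rfl
  ε_eq := rfl
  μ_eq _ _ := rfl

/-- The forgetful functor of a Hopf monad is closed on modules whose underlying object satisfies a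
property that is stable under internal homs. -/
theorem isClosedFunctor_forgetFull (hT : IsHopfMonad T)
    (hr : ∀ X Y, P X → P Y → ∃ H, P H ∧ ∃ e : H ⊗ X ⟶ Y, IsRightHom e)
    (hl : ∀ X Y, P X → P Y → ∃ H, P H ∧ ∃ e : X ⊗ H ⟶ Y, IsLeftHom e) :
    IsClosedFunctor (forgetFull T P) := by
  have hr' (M N : (moduleProp T P).FullSubcategory) :
      ∃ (L : (moduleProp T P).FullSubcategory) (e : L ⊗ M ⟶ N), IsRightHom e ∧
        IsRightHom (Functor.LaxMonoidal.μ (forgetFull T P) L M ≫ (forgetFull T P).map e) := by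
    obtain ⟨H, hH, e, he⟩ := hr M.obj.A N.obj.A M.property N.property
    obtain ⟨a, h₁, h₂, ev, hev⟩ := exists_module_of_isRightHom hT (M := M.obj) (N := N.obj) he
    exact ⟨⟨⟨H, a, h₁, h₂⟩, hH⟩, ObjectProperty.homMk ev, (he.of_forget hT hev).fullSubcategory rfl,
      he.fullSubcategory ((Category.id_comp _).trans hev)⟩
  have hl' (M N : (moduleProp T P).FullSubcategory) :
      ∃ (L : (moduleProp T P).FullSubcategory) (e : M ⊗ L ⟶ N), IsLeftHom e ∧
        IsLeftHom (Functor.LaxMonoidal.μ (forgetFull T P) M L ≫ (forgetFull T P).map e) := by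
    obtain ⟨H, hH, e, he⟩ := hl M.obj.A N.obj.A M.property N.property
    obtain ⟨a, h₁, h₂, ev, hev⟩ := exists_module_of_isLeftHom hT (M := M.obj) (N := N.obj) he
    exact ⟨⟨⟨H, a, h₁, h₂⟩, hH⟩, ObjectProperty.homMk ev, (he.of_forget hT hev).fullSubcategory rfl,
      he.fullSubcategory ((Category.id_comp _).trans hev)⟩
  exact
    { source :=
        { left M := isLeftAdjoint_tensorLeft M fun N =>
            let ⟨L, e, he, _⟩ := hl' M N
            ⟨L, e, he⟩
          right M := isLeftAdjoint_tensorRight M fun N =>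
            let ⟨L, e, he, _⟩ := hr' M N
            ⟨L, e, he⟩ }
      target :=
        { left X := isLeftAdjoint_tensorLeft X fun Y =>
            let ⟨H, hH, e, he⟩ := hl X.obj Y.obj X.property Y.property
            ⟨⟨H, hH⟩, ObjectProperty.homMk e, he.fullSubcategory rfl⟩
          right X := isLeftAdjoint_tensorRight X fun Y =>
            let ⟨H, hH, e, he⟩ := hr X.obj Y.obj X.property Y.property
            ⟨⟨H, hH⟩, ObjectProperty.homMk e, he.fullSubcategory rfl⟩ }
      left {M} _ adj _ adj' N :=
        let ⟨_, _, he, hFe⟩ := hl' M N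
        isIso_leftComparator _ he hFe adj adj'
      right {M} _ adj _ adj' N :=
        let ⟨_, _, he, hFe⟩ := hr' M N
        isIso_rightComparator _ he hFe adj adj' }

/-- A module over a Hopf monad is dualizing if its underlying object is. -/
theorem isDualizing_of_forgetFull (hT : IsHopfMonad T) (K : (moduleProp T P).FullSubcategory)
    (h₁ : ∀ X, P X → ∃ A, P A ∧ ∃ e : A ⊗ X ⟶ K.obj.A, IsPerfect e)
    (h₂ : ∀ X, P X → ∃ A, P A ∧ ∃ e : X ⊗ A ⟶ K.obj.A, IsPerfect e) : IsDualizing K := by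
  refine isDualizing_of_isPerfect (fun M => ?_) (fun M => ?_)
  · obtain ⟨A, hA, e, he⟩ := h₁ M.obj.A M.property
    -- One half of perfection produces the action. The evaluation is then a module map, so both
    -- halves lift.
    obtain ⟨a, ha₁, ha₂, ev, hev⟩ :=
      exists_module_of_isRightHom hT (M := M.obj) (N := K.obj) he.right
    exact ⟨⟨⟨A, a, ha₁, ha₂⟩, hA⟩, ObjectProperty.homMk ev, IsPerfect.fullSubcategory
      ⟨he.right.of_forget hT hev, he.left.of_forget hT hev⟩ rfl⟩
  · obtain ⟨A, hA, e, he⟩ := h₂ M.obj.A M.property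
    obtain ⟨a, ha₁, ha₂, ev, hev⟩ :=
      exists_module_of_isLeftHom hT (M := M.obj) (N := K.obj) he.left
    exact ⟨⟨⟨A, a, ha₁, ha₂⟩, hA⟩, ObjectProperty.homMk ev, IsPerfect.fullSubcategory
      ⟨he.right.of_forget hT hev, he.left.of_forget hT hev⟩ rfl⟩

end ForgetFull

/-! ### Finite-dimensional bimodules -/

section FiniteDimensional

variable {k R : Type u} [Field k] [Ring R] [Algebra k R]

theorem exists_isPerfect_left (X : RBimod k R) (hX : IsFD X) :
    ∃ A, IsFD A ∧ ∃ e : A ⊗ X ⟶ dualBimod k R, IsPerfect e :=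
  have : FiniteDimensional k X.X := hX
  ⟨_, RBimod.isFD_linearDual hX, RBimod.exists_isPerfect_linearDual_left X⟩

theorem exists_isPerfect_right (X : RBimod k R) (hX : IsFD X) :
    ∃ A, IsFD A ∧ ∃ e : X ⊗ A ⟶ dualBimod k R, IsPerfect e :=
  have : FiniteDimensional k X.X := hX
  ⟨_, RBimod.isFD_linearDual hX, RBimod.exists_isPerfect_linearDual_right X⟩

variable [FiniteDimensional k R]

/-- Take W perfectly paired with Y; the dual of X ⊗ W is the internal hom, and it stays
finite-dimensional. -/
theorem exists_isRightHom_isFD (X Y : RBimod k R) (hX : IsFD X) (hY : IsFD Y) :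
    ∃ H, IsFD H ∧ ∃ e : H ⊗ X ⟶ Y, IsRightHom e := by
  obtain ⟨W, hW, e₁, h₁⟩ := exists_isPerfect_right Y hY
  obtain ⟨H, hH, e₂, h₂⟩ := exists_isPerfect_left (X ⊗ W) (ObjectProperty.prop_tensor hX hW)
  exact ⟨H, hH, exists_isRightHom h₁.right h₂.right⟩

theorem exists_isLeftHom_isFD (X Y : RBimod k R) (hX : IsFD X) (hY : IsFD Y) :
    ∃ H, IsFD H ∧ ∃ e : X ⊗ H ⟶ Y, IsLeftHom e := by
  obtain ⟨W, hW, e₁, h₁⟩ := exists_isPerfect_left Y hY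
  obtain ⟨H, hH, e₂, h₂⟩ := exists_isPerfect_right (W ⊗ X) (ObjectProperty.prop_tensor hW hX)
  exact ⟨H, hH, exists_isLeftHom h₁.left h₂.left⟩

theorem isDualizing_dualFD : IsDualizing (dualFD k R) := by
  refine isDualizing_of_isPerfect (fun X => ?_) (fun X => ?_)
  · obtain ⟨A, hA, e, he⟩ := exists_isPerfect_left X.obj X.property
    exact ⟨⟨A, hA⟩, ObjectProperty.homMk e,
      IsPerfect.fullSubcategory (A := ⟨A, hA⟩) (X := X) (Y := dualFD k R) he rfl⟩
  · obtain ⟨A, hA, e, he⟩ := exists_isPerfect_right X.obj X.property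
    exact ⟨⟨A, hA⟩, ObjectProperty.homMk e,
      IsPerfect.fullSubcategory (A := X) (X := ⟨A, hA⟩) (Y := dualFD k R) he rfl⟩

end FiniteDimensional

end HopfAlgebroidGV

theorem mainTheorem10 {k R : Type u} [Field k] [Ring R] [Algebra k R] [FiniteDimensional k R]
    (B : HopfAlgebroidGV.HopfAlgebroid k R) :
    (∀ ω : HopfAlgebroidGV.DualModuleStructure B,
      HopfAlgebroidGV.IsDualizing ω.toFDMod ∧
      (HopfAlgebroidGV.forgetFD B).obj ω.toFDMod = HopfAlgebroidGV.dualFD k R) ∧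
    HopfAlgebroidGV.IsDualizing (HopfAlgebroidGV.dualFD k R) ∧
    HopfAlgebroidGV.IsStrictMonoidal (HopfAlgebroidGV.forgetFD B) ∧
    HopfAlgebroidGV.IsClosedFunctor (HopfAlgebroidGV.forgetFD B) :=
  ⟨fun _ => ⟨HopfAlgebroidGV.isDualizing_of_forgetFull B.hopf _
      HopfAlgebroidGV.exists_isPerfect_left HopfAlgebroidGV.exists_isPerfect_right, rfl⟩,
    HopfAlgebroidGV.isDualizing_dualFD, HopfAlgebroidGV.isStrictMonoidal_forgetFull,
    HopfAlgebroidGV.isClosedFunctor_forgetFull B.hopf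
      HopfAlgebroidGV.exists_isRightHom_isFD HopfAlgebroidGV.exists_isLeftHom_isFD⟩
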